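/- Let $R$ be a commutative ring with identity. An $R$-module $M$ is called \emph{Gorenstein projective} ($G$-projective) if there is an exact sequence of projective $R$-modules $$\cdots\to P_1\to P_0\to P^0\to P^1\to\cdots$$ which remains exact under $\operatorname{Hom}_R(-,Q)$ for every projective $R$-module $Q$ and such that $M\cong\operatorname{im}(P_0\to P^0)$. The Gorenstein projective dimension $\operatorname{Gpd}_R M$ is the least $n\ge 0$ for which there is an exact sequence $0\to G_n\to\cdots\to G_0\to M\to 0$ with all $G_i$ Gorenstein projective, and $\infty$ if there is no such $n$. The module $M$ is called \emph{super finitely presented} if there is an exact sequence $\cdots\to P_1\to P_0\to M\to 0$ in which every $P_i$ is a finitely generated projective $R$-module. Write $M^*=\operatorname{Hom}_R(M,R)$. The ring $R$ has \emph{property (B)} if every super finitely presented $R$-module has finite Gorenstein projective dimension. If $R$ is an integral domain with quotient field $K$, the rank of $M$ is $\dim_K(K\otimes_R M)$. \textbf{Theorem.} Let $R$ be an integral domain. (1) Let $M$ be a Gorenstein projective $R$-module of finite rank with $\operatorname{Gpd}_R M^*<\infty$. Then $M$ is super finitely presented and $M^*$ is Gorenstein projective. (2) If $R$ has property (B), then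 every Gorenstein projective $R$-module $M$ of finite rank is super finitely presented and $M^*$ is Gorenstein projective. -/

import Mathlib

open scoped TensorProduct

universe u v

/-- `M` is Gorenstein projective: there is a complete projective resolution
`⋯ → P 2 → P 1 → P 0 → P (-1) → ⋯`, i.e. an exact sequence of projective `R`-modules that stays
exact under `Hom_R(-, Q)` for every projective `R`-module `Q`, such that `M` is isomorphic to the
image of `P 1 → P 0`. -/
def IsGorensteinProjective (R : Type u) [CommRing R] (M : Type v) [AddCommGroup M] [Module R M] :
    Prop :=
  ∃ (P : ℤ → ModuleCat.{max u v} R) (d : ∀ i : ℤ, P (i + 1) →ₗ[R] P i),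
    (∀ i, Module.Projective R (P i)) ∧
    (∀ i, Function.Exact (d (i + 1)) (d i)) ∧
    (∀ (Q : Type (max u v)) [AddCommGroup Q] [Module R Q], Module.Projective R Q →
      ∀ i, Function.Exact
        (fun f : P i →ₗ[R] Q => f ∘ₗ d i)
        (fun f : P (i + 1) →ₗ[R] Q => f ∘ₗ d (i + 1))) ∧
    Nonempty (M ≃ₗ[R] LinearMap.range (d 0))

/-- There is an exact sequence `0 → G n → ⋯ → G 1 → G 0 → M → 0` with all `G i` Gorenstein
projective (the modules `G k` with `k > n` are zero). -/
def HasGorensteinProjectiveResolution (R : Type u) [CommRing R]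
    (M : Type v) [AddCommGroup M] [Module R M] (n : ℕ) : Prop :=
  ∃ (G : ℕ → ModuleCat.{max u v} R) (d : ∀ i : ℕ, G (i + 1) →ₗ[R] G i) (ε : G 0 →ₗ[R] M),
    (∀ i, IsGorensteinProjective R (G i)) ∧
    (∀ k, n < k → Subsingleton (G k)) ∧
    (∀ i, Function.Exact (d (i + 1)) (d i)) ∧
    Function.Exact (d 0) ε ∧
    Function.Surjective ε

/-- The Gorenstein projective dimension: the least length of a Gorenstein projective resolution,
and `⊤` if there is no resolution of finite length. -/
noncomputable def gorensteinProjectiveDim (R : Type u) [CommRing R]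
    (M : Type v) [AddCommGroup M] [Module R M] : ℕ∞ :=
  ⨅ (n : ℕ) (_ : HasGorensteinProjectiveResolution R M n), (n : ℕ∞)

/-- `M` is super finitely presented: it has a resolution `⋯ → P 1 → P 0 → M → 0` by finitely
generated projective modules. -/
def IsSuperFinitelyPresented (R : Type u) [CommRing R]
    (M : Type v) [AddCommGroup M] [Module R M] : Prop :=
  ∃ (P : ℕ → ModuleCat.{max u v} R) (d : ∀ i : ℕ, P (i + 1) →ₗ[R] P i) (ε : P 0 →ₗ[R] M),
    (∀ i, Module.Finite R (P i) ∧ Module.Projective R (P i)) ∧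
    (∀ i, Function.Exact (d (i + 1)) (d i)) ∧
    Function.Exact (d 0) ε ∧
    Function.Surjective ε

/-- Property (B): every super finitely presented `R`-module has finite Gorenstein projective
dimension. -/
def HasPropertyB (R : Type u) [CommRing R] : Prop :=
  ∀ (N : Type (max u v)) [AddCommGroup N] [Module R N],
    IsSuperFinitelyPresented R N → gorensteinProjectiveDim R N < ⊤

/-- The rank of a module over a domain `R` with quotient field `K`: the dimension of `K ⊗ M` over
`K`. -/
noncomputable def domainRank (R : Type u) [CommRing R] [IsDomain R]
    (M : Type v) [AddCommGroup M] [Module R M] : Cardinal :=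
  Module.rank (FractionRing R) (FractionRing R ⊗[R] M)

-- A complete resolution is cut into short exact sequences 0 → A → P → B → 0 such that maps from A
-- to projectives extend to P (`GorensteinStep`). Exactness under Hom(-, Q) is a condition on each
-- piece, so M is Gorenstein projective exactly when such steps continue forever from M in both
-- directions.
--
-- Let M be such a module of finite rank. It embeds in a free module, and after tensoring with the
-- quotient field K only finitely many coordinates occur. So M embeds in some R^J with J finite, and
-- the dual Schanuel lemma shows that the cokernel is again Gorenstein projective
-- (`HasGorensteinChain.exists_finiteGorensteinStep`). Iteration coresolves M by finite free
-- modules. The terms of this chain are reflexive, and dualizing reverses it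
-- (`FiniteGorensteinStep.dual_chain`): M^* is super finitely presented, with steps continuing
-- forever to its left.
--
-- Only the right half of a chain for M^* is missing, and finite Gorenstein dimension supplies it
-- (`HasChainResolution.hasGorensteinChain`). Then M^* is Gorenstein projective and finitely
-- generated, hence of finite rank, so its own dual M^** ≅ M is super finitely presented. Under (B)
-- the dimension of M^* is finite because M^* is super finitely presented already.

universe w

/-! ### Lifting and descent along exact sequences -/

section Diagram

variable {R : Type*} [Ring R] {A B C X : Type*} [AddCommGroup A] [AddCommGroup B]
  [AddCommGroup C] [AddCommGroup X] [Module R A] [Module R B] [Module R C] [Module R X]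

theorem Function.Exact.exists_lift {f : A →ₗ[R] B} {g : B →ₗ[R] C} (hfg : Function.Exact f g)
    (hf : Function.Injective f) (φ : X →ₗ[R] B) (hφ : ∀ x, g (φ x) = 0) :
    ∃ ψ : X →ₗ[R] A, ∀ x, f (ψ x) = φ x := by
  let e := LinearEquiv.ofInjective f hf
  refine ⟨e.symm.toLinearMap ∘ₗ φ.codRestrict (LinearMap.range f)
    (fun x => (hfg _).1 (hφ x)), fun x => ?_⟩
  have := congrArg Subtype.val (e.apply_symm_apply
    (φ.codRestrict (LinearMap.range f) (fun x => (hfg _).1 (hφ x)) x))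
  exact this

theorem Function.Exact.exists_desc {f : A →ₗ[R] B} {g : B →ₗ[R] C} (hfg : Function.Exact f g)
    (hg : Function.Surjective g) (φ : B →ₗ[R] X) (hφ : ∀ a, φ (f a) = 0) :
    ∃ ψ : C →ₗ[R] X, ∀ b, ψ (g b) = φ b := by
  have hk : LinearMap.ker g ≤ LinearMap.ker φ := by
    intro b hb
    obtain ⟨a, rfl⟩ := (hfg b).1 hb
    exact hφ a
  refine ⟨(LinearMap.ker g).liftQ φ hk ∘ₗ (g.quotKerEquivOfSurjective hg).symm.toLinearMap,
    fun b => ?_⟩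
  have : (g.quotKerEquivOfSurjective hg).symm (g b) = Submodule.Quotient.mk b := by
    rw [LinearEquiv.symm_apply_eq]; rfl
  simp [this]

end Diagram

/-! ### Gorenstein steps, two-sided chains and projective summands -/

section Step

/-- `0 → A → P → B → 0` is exact, `P` is projective, and every map from `A` to a projective module
extends to `P`. -/
structure IsGorensteinStep {R : Type u} [CommRing R] {A P B : Type w} [AddCommGroup A]
    [AddCommGroup P] [AddCommGroup B] [Module R A] [Module R P] [Module R B]
    (f : A →ₗ[R] P) (g : P →ₗ[R] B) : Prop where
  projective : Module.Projective R P
  injective : Function.Injective f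
  exact : Function.Exact f g
  surjective : Function.Surjective g
  extend : ∀ (Q : Type w) [AddCommGroup Q] [Module R Q], Module.Projective R Q →
    ∀ h : A →ₗ[R] Q, ∃ h' : P →ₗ[R] Q, ∀ a, h' (f a) = h a

/-- There is a Gorenstein step `0 → A → P → B → 0`. -/
def GorensteinStep (R : Type u) [CommRing R] (A B : Type w) [AddCommGroup A] [AddCommGroup B]
    [Module R A] [Module R B] : Prop :=
  ∃ (P : ModuleCat.{w} R) (f : A →ₗ[R] P) (g : P →ₗ[R] B), IsGorensteinStep f g

/-- There is a Gorenstein step `0 → A → P → B → 0` with `P` finitely generated. -/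
def FiniteGorensteinStep (R : Type u) [CommRing R] (A B : Type w) [AddCommGroup A]
    [AddCommGroup B] [Module R A] [Module R B] : Prop :=
  ∃ (P : ModuleCat.{w} R) (f : A →ₗ[R] P) (g : P →ₗ[R] B), Module.Finite R P ∧
    IsGorensteinStep f g

/-- There is a short exact sequence `0 → A → B → C → 0`. -/
def IsExtensionOf (R : Type u) [CommRing R] (A B C : Type w) [AddCommGroup A] [AddCommGroup B]
    [AddCommGroup C] [Module R A] [Module R B] [Module R C] : Prop :=
  ∃ (f : A →ₗ[R] B) (g : B →ₗ[R] C), Function.Injective f ∧ Function.Exact f g ∧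
    Function.Surjective g

/-- `M` is the zeroth term of a doubly infinite chain of modules linked by Gorenstein steps. -/
def HasGorensteinChain (R : Type u) [CommRing R] (M : Type w) [AddCommGroup M] [Module R M] :
    Prop :=
  ∃ Z : ℤ → ModuleCat.{w} R, (∀ i, GorensteinStep R (Z (i + 1)) (Z i)) ∧ Nonempty (M ≃ₗ[R] Z 0)

variable {R : Type u} [CommRing R] {A B C D M N P P' Q : Type w}
  [AddCommGroup A] [AddCommGroup B] [AddCommGroup C] [AddCommGroup D] [AddCommGroup M]
  [AddCommGroup N] [AddCommGroup P] [AddCommGroup P'] [AddCommGroup Q]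
  [Module R A] [Module R B] [Module R C] [Module R D] [Module R M] [Module R N] [Module R P]
  [Module R P'] [Module R Q]

theorem IsGorensteinStep.step {f : A →ₗ[R] P} {g : P →ₗ[R] B} (h : IsGorensteinStep f g) :
    GorensteinStep R A B :=
  ⟨ModuleCat.of R P, f, g, h⟩

theorem FiniteGorensteinStep.step (h : FiniteGorensteinStep R A B) : GorensteinStep R A B := by
  obtain ⟨P, f, g, -, h⟩ := h
  exact ⟨P, f, g, h⟩

theorem IsGorensteinStep.congr {f : A →ₗ[R] P} {g : P →ₗ[R] B} (h : IsGorensteinStep f g)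
    (e : C ≃ₗ[R] A) (e' : B ≃ₗ[R] D) :
    IsGorensteinStep (f ∘ₗ e.toLinearMap) (e'.toLinearMap ∘ₗ g) where
  projective := h.projective
  injective := h.injective.comp e.injective
  exact := fun p => by
    simp only [LinearMap.coe_comp, LinearEquiv.coe_coe, Function.comp_apply,
      LinearEquiv.map_eq_zero_iff, Set.mem_range]
    rw [h.exact p]
    exact ⟨fun ⟨a, ha⟩ => ⟨e.symm a, by simpa using ha⟩, fun ⟨c, hc⟩ => ⟨e c, hc⟩⟩
  surjective := e'.surjective.comp h.surjective
  extend := fun Q _ _ hQ k => by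
    obtain ⟨k', hk'⟩ := h.extend Q hQ (k ∘ₗ e.symm.toLinearMap)
    exact ⟨k', fun c => by simp [hk']⟩

theorem GorensteinStep.congr (h : GorensteinStep R A B) (e : C ≃ₗ[R] A) (e' : B ≃ₗ[R] D) :
    GorensteinStep R C D := by
  obtain ⟨P, f, g, h⟩ := h
  exact (h.congr e e').step

theorem exists_forall_nat_of_step {α : Type*} {C : α → Prop} {r : α → α → Prop}
    (hC : ∀ a, C a → ∃ b, r a b ∧ C b) {a : α} (ha : C a) :
    ∃ z : ℕ → α, z 0 = a ∧ ∀ n, C (z n) ∧ r (z n) (z (n + 1)) := by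
  choose! s hs using hC
  let z : ℕ → α := fun n => s^[n] a
  have hz : ∀ n, C (z n) := by
    intro n
    induction n with
    | zero => exact ha
    | succ n ih =>
      simp only [z, Function.iterate_succ_apply']
      exact (hs _ ih).2
  refine ⟨z, rfl, fun n => ⟨hz n, ?_⟩⟩
  simp only [z, Function.iterate_succ_apply']
  exact (hs _ (hz n)).1

/-- The two halves of a chain are chosen independently, so closure properties only require one step
in each direction within a suitable class. -/
theorem HasGorensteinChain.coinduction {C : ModuleCat.{w} R → Prop}
    (hl : ∀ X, C X → ∃ Y : ModuleCat.{w} R, GorensteinStep R Y X ∧ C Y)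
    (hr : ∀ X, C X → ∃ Y : ModuleCat.{w} R, GorensteinStep R X Y ∧ C Y)
    (hM : C (ModuleCat.of R M)) : HasGorensteinChain R M := by
  obtain ⟨x, hx0, hx⟩ := exists_forall_nat_of_step (r := fun X Y : ModuleCat.{w} R => GorensteinStep R Y X) hl hM
  obtain ⟨y, hy0, hy⟩ := exists_forall_nat_of_step (r := fun X Y : ModuleCat.{w} R => GorensteinStep R X Y) hr hM
  -- Both sequences start at M, so index -1 receives `y 1`; `y 0` would repeat `x 0`.
  let z : ℤ → ModuleCat.{w} R := fun i => match i with
    | Int.ofNat n => x n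
    | Int.negSucc n => y (n + 1)
  refine ⟨z, fun i => ?_, ⟨?_⟩⟩
  · match i with
    | Int.ofNat n => exact (hx n).2
    | Int.negSucc 0 =>
      change GorensteinStep R (x 0) (y 1)
      rw [hx0, ← hy0]
      exact (hy 0).2
    | Int.negSucc (n + 1) => exact (hy (n + 1)).2
  · change M ≃ₗ[R] x 0
    rw [hx0]

theorem HasGorensteinChain.congr (h : HasGorensteinChain R M) (e : N ≃ₗ[R] M) :
    HasGorensteinChain R N := by
  obtain ⟨Z, hZ, ⟨e'⟩⟩ := h
  exact ⟨Z, hZ, ⟨e.trans e'⟩⟩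

theorem HasGorensteinChain.shift {Z : ℤ → ModuleCat.{w} R}
    (hZ : ∀ i, GorensteinStep R (Z (i + 1)) (Z i)) (k : ℤ) : HasGorensteinChain R (Z k) := by
  refine ⟨fun i => Z (k + i), fun i => ?_, ⟨?_⟩⟩
  · have := hZ (k + i)
    rwa [add_assoc] at this
  · change Z k ≃ₗ[R] Z (k + 0)
    rw [add_zero]

theorem HasGorensteinChain.exists_left (h : HasGorensteinChain R M) :
    ∃ N : ModuleCat.{w} R, GorensteinStep R N M ∧ HasGorensteinChain R N := by
  obtain ⟨Z, hZ, ⟨e⟩⟩ := h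
  exact ⟨Z (0 + 1), (hZ 0).congr (LinearEquiv.refl _ _) e.symm, HasGorensteinChain.shift hZ _⟩

theorem HasGorensteinChain.exists_right (h : HasGorensteinChain R M) :
    ∃ N : ModuleCat.{w} R, GorensteinStep R M N ∧ HasGorensteinChain R N := by
  obtain ⟨Z, hZ, ⟨e⟩⟩ := h
  refine ⟨Z (-1), GorensteinStep.congr (hZ (-1)) ?_ (LinearEquiv.refl _ _),
    HasGorensteinChain.shift hZ _⟩
  exact e

theorem HasGorensteinChain.of_steps (h₁ : GorensteinStep R A M) (hA : HasGorensteinChain R A)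
    (h₂ : GorensteinStep R M B) (hB : HasGorensteinChain R B) : HasGorensteinChain R M := by
  refine HasGorensteinChain.coinduction
    (C := fun X => HasGorensteinChain R X ∨ X = ModuleCat.of R M) ?_ ?_ (Or.inr rfl)
  · rintro X (hX | rfl)
    · obtain ⟨Y, hY, hY'⟩ := hX.exists_left
      exact ⟨Y, hY, Or.inl hY'⟩
    · exact ⟨ModuleCat.of R A, h₁, Or.inl hA⟩
  · rintro X (hX | rfl)
    · obtain ⟨Y, hY, hY'⟩ := hX.exists_right
      exact ⟨Y, hY, Or.inl hY'⟩
    · exact ⟨ModuleCat.of R B, h₂, Or.inl hB⟩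

/-- Dual Schanuel lemma. -/
theorem IsGorensteinStep.schanuel {f : A →ₗ[R] P} {g : P →ₗ[R] B} {f' : A →ₗ[R] P'}
    {g' : P' →ₗ[R] C} (h : IsGorensteinStep f g) (h' : IsGorensteinStep f' g') :
    Nonempty ((B × P') ≃ₗ[R] (C × P)) := by
  obtain ⟨t, ht⟩ := h.extend P' h'.projective f'
  obtain ⟨t', ht'⟩ := h'.extend P h.projective f
  -- Both maps are surjections out of P × P' whose kernel is the diagonal image of A.
  let φ : P × P' →ₗ[R] B × P' :=
    (g ∘ₗ LinearMap.fst R P P').prod (LinearMap.snd R P P' - t ∘ₗ LinearMap.fst R P P')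
  let ψ : P × P' →ₗ[R] C × P :=
    (g' ∘ₗ LinearMap.snd R P P').prod (LinearMap.fst R P P' - t' ∘ₗ LinearMap.snd R P P')
  have hφ : Function.Surjective φ := by
    rintro ⟨b, p'⟩
    obtain ⟨p, rfl⟩ := h.surjective b
    exact ⟨(p, p' + t p), by simp [φ]⟩
  have hψ : Function.Surjective ψ := by
    rintro ⟨c, p⟩
    obtain ⟨p', rfl⟩ := h'.surjective c
    exact ⟨(p + t' p', p'), by simp [ψ]⟩
  have hk : LinearMap.ker φ = LinearMap.ker ψ := by
    ext ⟨p, p'⟩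
    simp only [LinearMap.mem_ker, φ, ψ, LinearMap.prod_apply, Function.prod_apply, LinearMap.comp_apply,
      LinearMap.sub_apply, LinearMap.fst_apply, LinearMap.snd_apply, Prod.mk_eq_zero, sub_eq_zero]
    constructor
    · rintro ⟨hp, rfl⟩
      obtain ⟨a, rfl⟩ := (h.exact p).1 hp
      rw [ht, ht']
      exact ⟨h'.exact.apply_apply_eq_zero a, rfl⟩
    · rintro ⟨hp, rfl⟩
      obtain ⟨a, rfl⟩ := (h'.exact p').1 hp
      rw [ht', ht]
      exact ⟨h.exact.apply_apply_eq_zero a, rfl⟩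
  exact ⟨(φ.quotKerEquivOfSurjective hφ).symm.trans
    ((Submodule.quotEquivOfEq _ _ hk).trans (ψ.quotKerEquivOfSurjective hψ))⟩

theorem GorensteinStep.prod_right (h : GorensteinStep R A B) (hQ : Module.Projective R Q) :
    GorensteinStep R A (B × Q) := by
  obtain ⟨P, f, g, h⟩ := h
  have := h.projective
  refine IsGorensteinStep.step (P := P × Q) (f := (LinearMap.inl R P Q) ∘ₗ f)
    (g := g.prodMap LinearMap.id) ⟨inferInstance, LinearMap.inl_injective.comp h.injective,
      ?_, ?_, ?_⟩
  · rintro ⟨p, q⟩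
    simp only [LinearMap.prodMap_apply, LinearMap.id_apply, Prod.mk_eq_zero, LinearMap.coe_comp,
      LinearMap.coe_inl, Set.mem_range, Function.comp_apply, Prod.mk.injEq, h.exact p]
    exact ⟨fun ⟨⟨a, ha⟩, hq⟩ => ⟨a, ha, hq.symm⟩, fun ⟨a, ha, hq⟩ => ⟨⟨a, ha⟩, hq.symm⟩⟩
  · rintro ⟨b, q⟩
    obtain ⟨p, rfl⟩ := h.surjective b
    exact ⟨(p, q), rfl⟩
  · intro Q' _ _ hQ' k
    obtain ⟨k', hk'⟩ := h.extend Q' hQ' k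
    exact ⟨k' ∘ₗ LinearMap.fst R P Q, fun a => by simp [hk']⟩

theorem GorensteinStep.prod_left (h : GorensteinStep R A B) (hQ : Module.Projective R Q) :
    GorensteinStep R (A × Q) B := by
  obtain ⟨P, f, g, h⟩ := h
  have := h.projective
  refine IsGorensteinStep.step (P := P × Q) (f := f.prodMap LinearMap.id)
    (g := g ∘ₗ LinearMap.fst R P Q) ⟨inferInstance, ?_, ?_, ?_, ?_⟩
  · exact h.injective.prodMap Function.injective_id
  · rintro ⟨p, q⟩
    simp only [LinearMap.coe_comp, LinearMap.coe_fst, Function.comp_apply, h.exact p,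
      Set.mem_range, LinearMap.prodMap_apply, LinearMap.id_apply, Prod.mk.injEq, Prod.exists]
    exact ⟨fun ⟨a, ha⟩ => ⟨a, q, ha, rfl⟩, fun ⟨a, _, ha, _⟩ => ⟨a, ha⟩⟩
  · exact h.surjective.comp Prod.fst_surjective
  · intro Q' _ _ hQ' k
    obtain ⟨k', hk'⟩ := h.extend Q' hQ' (k ∘ₗ LinearMap.inl R A Q)
    refine ⟨k'.coprod (k ∘ₗ LinearMap.inr R A Q), fun ⟨a, q⟩ => ?_⟩
    simp [hk', ← map_add]

theorem HasGorensteinChain.prod (h : HasGorensteinChain R M) (hQ : Module.Projective R Q) :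
    HasGorensteinChain R (M × Q) := by
  obtain ⟨A, hA, hA'⟩ := h.exists_left
  obtain ⟨B, hB, hB'⟩ := h.exists_right
  exact HasGorensteinChain.of_steps (hA.prod_right hQ) hA' (hB.prod_left hQ) hB'

/-- The composite P → B × Q → Q splits, so its kernel is projective and serves as the middle term.
-/
theorem GorensteinStep.of_prod_right (h : GorensteinStep R A (B × Q))
    (hQ : Module.Projective R Q) : GorensteinStep R A B := by
  obtain ⟨P, f, g, h⟩ := h
  have := h.projective
  let q : P →ₗ[R] Q := LinearMap.snd R B Q ∘ₗ g
  have hq : Function.Surjective q := Prod.snd_surjective.comp h.surjective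
  obtain ⟨s, hs⟩ := Module.projective_lifting_property q LinearMap.id hq
  have hs' : ∀ x, q (s x) = x := fun x => LinearMap.congr_fun hs x
  have hproj : Module.Projective R (LinearMap.ker q) := by
    let r : P →ₗ[R] LinearMap.ker q := (LinearMap.id - s ∘ₗ q).codRestrict (LinearMap.ker q)
      fun x => by simp [hs']
    refine Module.Projective.of_split (LinearMap.ker q).subtype r
      (LinearMap.ext fun x => Subtype.ext ?_)
    change (x : P) - s (q x) = x
    rw [LinearMap.mem_ker.1 x.2, map_zero, sub_zero]
  have hfq : ∀ a, q (f a) = 0 := fun a => by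
    have := h.exact.apply_apply_eq_zero a
    simp [q, this]
  refine IsGorensteinStep.step (f := f.codRestrict (LinearMap.ker q) hfq)
    (g := LinearMap.fst R B Q ∘ₗ g ∘ₗ (LinearMap.ker q).subtype) ⟨hproj, ?_, ?_, ?_, ?_⟩
  · intro a b hab
    exact h.injective (congrArg Subtype.val hab)
  · rintro ⟨x, hx⟩
    have hx' : (g x).2 = 0 := hx
    have := h.exact x
    simp only [LinearMap.coe_comp, Function.comp_apply, Submodule.coe_subtype, LinearMap.coe_fst,
      Set.mem_range]
    rw [Prod.ext_iff] at this
    simp only [hx', Prod.fst_zero, Prod.snd_zero, and_true] at this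
    rw [this]
    exact ⟨fun ⟨a, ha⟩ => ⟨a, Subtype.ext ha⟩, fun ⟨a, ha⟩ => ⟨a, congrArg Subtype.val ha⟩⟩
  · intro b
    obtain ⟨x, hx⟩ := h.surjective (b, 0)
    exact ⟨⟨x, by simp [q, hx]⟩, by simp [hx]⟩
  · intro Q' _ _ hQ' k
    obtain ⟨k', hk'⟩ := h.extend Q' hQ' k
    exact ⟨k' ∘ₗ (LinearMap.ker q).subtype, hk'⟩

/-- The projection A × Q → Q extends to P, and this extension becomes the second component of the
new quotient map: the summand Q moves across the step. -/
theorem GorensteinStep.of_prod_left (h : GorensteinStep R (A × Q) B)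
    (hQ : Module.Projective R Q) : GorensteinStep R A (B × Q) := by
  obtain ⟨P, f, g, h⟩ := h
  have := h.projective
  obtain ⟨t, ht⟩ := h.extend Q hQ (LinearMap.snd R A Q)
  refine IsGorensteinStep.step (f := f ∘ₗ LinearMap.inl R A Q)
    (g := g.prod t) ⟨h.projective, h.injective.comp LinearMap.inl_injective, ?_, ?_, ?_⟩
  · intro p
    simp only [LinearMap.prod_apply, Function.prod_apply, Prod.mk_eq_zero, Set.mem_range, LinearMap.coe_comp,
      Function.comp_apply, LinearMap.inl_apply]
    constructor
    · rintro ⟨h1, h2⟩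
      obtain ⟨⟨a, q⟩, rfl⟩ := (h.exact p).1 h1
      rw [ht] at h2
      exact ⟨a, by rw [show q = 0 from h2]⟩
    · rintro ⟨a, rfl⟩
      exact ⟨h.exact.apply_apply_eq_zero _, by rw [ht]; rfl⟩
  · rintro ⟨b, q⟩
    obtain ⟨p, rfl⟩ := h.surjective b
    refine ⟨p + f (0, q - t p), ?_⟩
    simp [h.exact.apply_apply_eq_zero, ht]
  · intro Q' _ _ hQ' k
    obtain ⟨k', hk'⟩ := h.extend Q' hQ' (k ∘ₗ LinearMap.fst R A Q)
    exact ⟨k', fun a => by simp [hk']⟩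

theorem HasGorensteinChain.of_prod (h : HasGorensteinChain R (M × Q))
    (hQ : Module.Projective R Q) : HasGorensteinChain R M := by
  obtain ⟨A, hA, hA'⟩ := h.exists_left
  obtain ⟨B, hB, hB'⟩ := h.exists_right
  exact HasGorensteinChain.of_steps (hA.of_prod_right hQ) hA' (hB.of_prod_left hQ) (hB'.prod hQ)

/-- The chain of A has its own right neighbour C; by Schanuel, B and C agree up to projective
summands. -/
theorem HasGorensteinChain.of_step_left (hA : HasGorensteinChain R A) (h : GorensteinStep R A B) :
    HasGorensteinChain R B := by
  obtain ⟨C, ⟨P', f', g', h'⟩, hC⟩ := hA.exists_right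
  obtain ⟨P, f, g, h⟩ := h
  obtain ⟨e⟩ := h.schanuel h'
  exact ((hC.prod h.projective).congr e).of_prod h'.projective

end Step

/-! ### Extensions, kernels and finite resolutions -/

section Extension

variable {R : Type u} [CommRing R] {A B C D E M N P P' Q : Type w}
  [AddCommGroup A] [AddCommGroup B] [AddCommGroup C] [AddCommGroup D] [AddCommGroup E]
  [AddCommGroup M]
  [AddCommGroup N] [AddCommGroup P] [AddCommGroup P'] [AddCommGroup Q]
  [Module R A] [Module R B] [Module R C] [Module R D] [Module R E] [Module R M] [Module R N]
  [Module R P] [Module R P'] [Module R Q]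

/-- Lifting g to E rotates the extension: E becomes the quotient of A × P by the syzygy C of B. -/
theorem exists_cone_sequence {i : A →ₗ[R] E} {π : E →ₗ[R] B} (hi : Function.Injective i)
    (hiπ : Function.Exact i π) (hπ : Function.Surjective π) {f : C →ₗ[R] P} {g : P →ₗ[R] B}
    (hf : Function.Injective f) (hfg : Function.Exact f g) (hg : Function.Surjective g)
    (hP : Module.Projective R P) :
    ∃ (φ : C →ₗ[R] A × P) (ψ : A × P →ₗ[R] E), Function.Injective φ ∧ Function.Exact φ ψ ∧
      Function.Surjective ψ ∧ (∀ c, (φ c).2 = f c) ∧ (∀ a, ψ (a, 0) = i a) := by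
  obtain ⟨σ, hσ⟩ := Module.projective_lifting_property π g hπ
  have hσ' : ∀ p, π (σ p) = g p := fun p => LinearMap.congr_fun hσ p
  obtain ⟨α, hα⟩ := hiπ.exists_lift hi (σ ∘ₗ f) fun c => by
    simp [hσ', hfg.apply_apply_eq_zero]
  refine ⟨(-α).prod f, i.coprod σ, fun x y hxy => hf (congrArg Prod.snd hxy), ?_, ?_,
    fun c => rfl, fun a => by simp⟩
  · rintro ⟨a, p⟩
    constructor
    · intro h
      have h0 : i a + σ p = 0 := by simpa using h
      have h1 : g p = 0 := by
        have := congrArg π h0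
        simpa [hiπ.apply_apply_eq_zero, hσ'] using this
      obtain ⟨c, rfl⟩ := (hfg p).1 h1
      refine ⟨c, ?_⟩
      simp only [LinearMap.prod_apply, Function.prod_apply, Prod.mk.injEq, LinearMap.neg_apply,
        and_true]
      refine hi ?_
      rw [map_neg, hα]
      exact (eq_neg_of_add_eq_zero_left h0).symm
    · rintro ⟨c, hc⟩
      rw [← hc]
      simp [hα]
  · intro e
    obtain ⟨p, hp⟩ := hg (π e)
    obtain ⟨a, ha⟩ := (hiπ (e - σ p)).1 (by rw [map_sub, hσ', hp, sub_self])
    exact ⟨(a, p), by simp [ha]⟩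

/-- A step ending in B encodes Ext¹(B, Q) = 0 for projective Q. -/
theorem GorensteinStep.extend_of_isExtension {i : A →ₗ[R] E} {π : E →ₗ[R] B}
    (hi : Function.Injective i) (hiπ : Function.Exact i π) (hπ : Function.Surjective π)
    (h : GorensteinStep R C B) (hQ : Module.Projective R Q) (k : A →ₗ[R] Q) :
    ∃ k' : E →ₗ[R] Q, ∀ a, k' (i a) = k a := by
  obtain ⟨P, f, g, h⟩ := h
  obtain ⟨φ, ψ, -, hφψ, hψ, hφ2, hψ1⟩ :=
    exists_cone_sequence hi hiπ hπ h.injective h.exact h.surjective h.projective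
  obtain ⟨t, ht⟩ := h.extend Q hQ (k ∘ₗ LinearMap.fst R A P ∘ₗ φ)
  obtain ⟨k', hk'⟩ := hφψ.exists_desc hψ
    (k ∘ₗ LinearMap.fst R A P - t ∘ₗ LinearMap.snd R A P) fun c => by
      simp [hφ2, ht]
  exact ⟨k', fun a => by rw [← hψ1, hk']; simp⟩

/-- Horseshoe lemma; the extension property is assembled from those of the two outer steps. -/
theorem IsExtensionOf.exists_step_left (hE : IsExtensionOf R A E B) (hA : GorensteinStep R C A)
    (hB : GorensteinStep R D B) :
    ∃ E' : ModuleCat.{w} R, GorensteinStep R E' E ∧ IsExtensionOf R C E' D := by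
  obtain ⟨i, π, hi, hiπ, hπ⟩ := hE
  obtain ⟨P, f, g, hA⟩ := hA
  obtain ⟨P', f', g', hB⟩ := hB
  have := hA.projective
  have := hB.projective
  obtain ⟨σ, hσ⟩ := Module.projective_lifting_property π g' hπ
  have hσ' : ∀ p, π (σ p) = g' p := fun p => LinearMap.congr_fun hσ p
  let ψ : P × P' →ₗ[R] E := (i ∘ₗ g).coprod σ
  have hψ : ∀ p p', ψ (p, p') = i (g p) + σ p' := fun p p' => by simp [ψ]
  let ι : C →ₗ[R] LinearMap.ker ψ := (LinearMap.inl R P P' ∘ₗ f).codRestrict (LinearMap.ker ψ)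
    fun c => by simp [hψ, hA.exact.apply_apply_eq_zero]
  have hι : ∀ c, (ι c : P × P') = (f c, 0) := fun c => rfl
  obtain ⟨ρ, hρ⟩ := hB.exact.exists_lift hB.injective
    (LinearMap.snd R P P' ∘ₗ (LinearMap.ker ψ).subtype) fun ⟨⟨p, p'⟩, hx⟩ => by
      have := congrArg π (LinearMap.mem_ker.1 hx)
      simpa [hψ, hσ', hiπ.apply_apply_eq_zero] using this
  have hρ' : ∀ x : LinearMap.ker ψ, f' (ρ x) = (x : P × P').2 := hρ
  have hιi : Function.Injective ι := fun x y hxy =>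
    hA.injective (congrArg Prod.fst (congrArg Subtype.val hxy))
  have hex : Function.Exact ι ρ := by
    rintro ⟨⟨p, p'⟩, hx⟩
    constructor
    · intro h
      have h1 : p' = 0 := by
        have := hρ' ⟨⟨p, p'⟩, hx⟩
        rw [h, map_zero] at this
        exact this.symm
      subst h1
      have h2 : i (g p) = 0 := by
        have := LinearMap.mem_ker.1 hx
        simpa [hψ] using this
      obtain ⟨c, rfl⟩ := (hA.exact p).1 (hi (h2.trans (map_zero i).symm))
      exact ⟨c, rfl⟩
    · rintro ⟨c, hc⟩
      refine hB.injective ?_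
      rw [hρ', ← hc, hι, map_zero]
  have hρs : Function.Surjective ρ := by
    intro d
    obtain ⟨a, ha⟩ := (hiπ (σ (f' d))).1 (by rw [hσ', hB.exact.apply_apply_eq_zero])
    obtain ⟨p, rfl⟩ := hA.surjective a
    refine ⟨⟨(-p, f' d), ?_⟩, ?_⟩
    · rw [LinearMap.mem_ker, hψ, map_neg, map_neg, ha, neg_add_cancel]
    · exact hB.injective (hρ' _)
  refine ⟨ModuleCat.of R (LinearMap.ker ψ), ?_, ι, ρ, hιi, hex, hρs⟩
  refine IsGorensteinStep.step (f := (LinearMap.ker ψ).subtype) (g := ψ)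
    ⟨inferInstance, Subtype.val_injective, ?_, ?_, ?_⟩
  · exact LinearMap.exact_subtype_ker_map ψ
  · intro e
    obtain ⟨p', hp'⟩ := hB.surjective (π e)
    obtain ⟨a, ha⟩ := (hiπ (e - σ p')).1 (by rw [map_sub, hσ', hp', sub_self])
    obtain ⟨p, rfl⟩ := hA.surjective a
    exact ⟨(p, p'), by rw [hψ, ha, sub_add_cancel]⟩
  · intro Q _ _ hQ k
    obtain ⟨s, hs⟩ := hA.extend Q hQ (k ∘ₗ ι)
    obtain ⟨m, hm⟩ := hex.exists_desc hρs
      (k - s ∘ₗ LinearMap.fst R P P' ∘ₗ (LinearMap.ker ψ).subtype) fun c => by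
        simp [hι, hs]
    obtain ⟨t, ht⟩ := hB.extend Q hQ m
    refine ⟨s.coprod t, fun x => ?_⟩
    simp only [LinearMap.coprod_apply, Submodule.subtype_apply]
    rw [← hρ', ht, hm]
    simp

/-- Dual horseshoe lemma. The step ending in B is what allows A → P to be extended over E. -/
theorem IsExtensionOf.exists_step_right (hE : IsExtensionOf R A E B) (hA : GorensteinStep R A C)
    (hB : GorensteinStep R B D) (hB' : GorensteinStep R M B) :
    ∃ E' : ModuleCat.{w} R, GorensteinStep R E E' ∧ IsExtensionOf R C E' D := by
  obtain ⟨i, π, hi, hiπ, hπ⟩ := hE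
  obtain ⟨P, f, g, hA⟩ := hA
  obtain ⟨P', f', g', hB⟩ := hB
  have := hA.projective
  have := hB.projective
  obtain ⟨α, hα⟩ := hB'.extend_of_isExtension hi hiπ hπ hA.projective f
  let φ : E →ₗ[R] P × P' := α.prod (f' ∘ₗ π)
  have hφ : ∀ e, φ e = (α e, f' (π e)) := fun e => rfl
  have hφi : Function.Injective φ := by
    rw [injective_iff_map_eq_zero]
    intro e he
    rw [hφ, Prod.mk_eq_zero] at he
    obtain ⟨a, rfl⟩ := (hiπ e).1 (hB.injective (he.2.trans (map_zero f').symm))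
    rw [hα] at he
    rw [hA.injective (he.1.trans (map_zero f).symm), map_zero]
  let q : P × P' →ₗ[R] (P × P') ⧸ LinearMap.range φ := (LinearMap.range φ).mkQ
  have hq : Function.Surjective q := Submodule.mkQ_surjective _
  have hφq : Function.Exact φ q := LinearMap.exact_map_mkQ_range φ
  obtain ⟨ι, hι⟩ := hA.exact.exists_desc hA.surjective (q ∘ₗ LinearMap.inl R P P') fun a => by
    have : LinearMap.inl R P P' (f a) = φ (i a) := by
      simp [hφ, hα, hiπ.apply_apply_eq_zero]
    rw [LinearMap.comp_apply, this, hφq.apply_apply_eq_zero]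
  have hι' : ∀ p, ι (g p) = q (p, 0) := hι
  obtain ⟨ρ, hρ⟩ := hφq.exists_desc hq (g' ∘ₗ LinearMap.snd R P P') fun e => by
    simp [hφ, hB.exact.apply_apply_eq_zero]
  have hρ' : ∀ p p', ρ (q (p, p')) = g' p' := fun p p' => hρ (p, p')
  have hιi : Function.Injective ι := by
    rw [injective_iff_map_eq_zero]
    intro c hc
    obtain ⟨p, rfl⟩ := hA.surjective c
    rw [hι'] at hc
    obtain ⟨e, he⟩ := (hφq _).1 hc
    rw [hφ, Prod.mk.injEq] at he
    obtain ⟨a, rfl⟩ := (hiπ e).1 (hB.injective (he.2.trans (map_zero f').symm))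
    rw [← he.1, hα, hA.exact.apply_apply_eq_zero]
  have hex : Function.Exact ι ρ := by
    intro x
    obtain ⟨⟨p, p'⟩, rfl⟩ := hq x
    constructor
    · intro h
      rw [hρ'] at h
      obtain ⟨b, rfl⟩ := (hB.exact p').1 h
      obtain ⟨e, rfl⟩ := hπ b
      refine ⟨g (p - α e), ?_⟩
      rw [hι', ← sub_eq_zero, ← map_sub, hφq]
      exact ⟨-e, by simp [hφ]⟩
    · rintro ⟨c, hc⟩
      obtain ⟨p₀, rfl⟩ := hA.surjective c
      rw [← hc, hι', hρ', map_zero]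
  have hρs : Function.Surjective ρ := by
    intro d
    obtain ⟨p', rfl⟩ := hB.surjective d
    exact ⟨q (0, p'), hρ' _ _⟩
  refine ⟨ModuleCat.of R ((P × P') ⧸ LinearMap.range φ), ?_, ι, ρ, hιi, hex, hρs⟩
  refine IsGorensteinStep.step (f := φ) (g := q) ⟨inferInstance, hφi, hφq, hq, ?_⟩
  intro Q _ _ hQ k
  obtain ⟨s, hs⟩ := hA.extend Q hQ (k ∘ₗ i)
  obtain ⟨m, hm⟩ := hiπ.exists_desc hπ (k - s ∘ₗ α) fun a => by simp [hα, hs]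
  obtain ⟨t, ht⟩ := hB.extend Q hQ m
  refine ⟨s.coprod t, fun e => ?_⟩
  rw [hφ, LinearMap.coprod_apply, ht, hm]
  simp

theorem IsExtensionOf.hasGorensteinChain (hE : IsExtensionOf R A E B)
    (hA : HasGorensteinChain R A) (hB : HasGorensteinChain R B) : HasGorensteinChain R E := by
  refine HasGorensteinChain.coinduction
    (C := fun X => ∃ A B : ModuleCat.{w} R, IsExtensionOf R A X B ∧ HasGorensteinChain R A ∧
      HasGorensteinChain R B) ?_ ?_ ⟨ModuleCat.of R A, ModuleCat.of R B, hE, hA, hB⟩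
  · rintro X ⟨A, B, hX, hA, hB⟩
    obtain ⟨A', hA', hA''⟩ := hA.exists_left
    obtain ⟨B', hB', hB''⟩ := hB.exists_left
    obtain ⟨X', hX', hX''⟩ := hX.exists_step_left hA' hB'
    exact ⟨X', hX', A', B', hX'', hA'', hB''⟩
  · rintro X ⟨A, B, hX, hA, hB⟩
    obtain ⟨A', hA', hA''⟩ := hA.exists_right
    obtain ⟨B', hB', hB''⟩ := hB.exists_right
    obtain ⟨B₀, hB₀, -⟩ := hB.exists_left
    obtain ⟨X', hX', hX''⟩ := hX.exists_step_right hA' hB' hB₀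
    exact ⟨X', hX', A', B', hX'', hA'', hB''⟩

theorem IsExtensionOf.exists_cone (hE : IsExtensionOf R A E B) (h : GorensteinStep R C B) :
    ∃ P : ModuleCat.{w} R, Module.Projective R P ∧ IsExtensionOf R C (A × P) E := by
  obtain ⟨i, π, hi, hiπ, hπ⟩ := hE
  obtain ⟨P, f, g, h⟩ := h
  obtain ⟨φ, ψ, hφ, hφψ, hψ, -, -⟩ :=
    exists_cone_sequence hi hiπ hπ h.injective h.exact h.surjective h.projective
  exact ⟨P, h.projective, φ, ψ, hφ, hφψ, hψ⟩

theorem IsExtensionOf.hasGorensteinChain_left (hE : IsExtensionOf R A E B)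
    (h : HasGorensteinChain R E) (hB : HasGorensteinChain R B) : HasGorensteinChain R A := by
  obtain ⟨C, hC, hC'⟩ := hB.exists_left
  obtain ⟨P, hP, hX⟩ := hE.exists_cone hC
  exact (hX.hasGorensteinChain hC' h).of_prod hP

/-- `N` has a resolution of length at most `n` by modules with a Gorenstein chain. -/
def HasChainResolution (R : Type u) [CommRing R] :
    ℕ → ∀ (N : Type w) [AddCommGroup N] [Module R N], Prop
  | 0, N, _, _ => HasGorensteinChain R N
  | n + 1, N, _, _ => ∃ K G : ModuleCat.{w} R, IsExtensionOf R K G N ∧ HasGorensteinChain R G ∧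
      HasChainResolution R n K

theorem HasChainResolution.prod {n : ℕ} (h : HasChainResolution R n N)
    (hQ : Module.Projective R Q) : HasChainResolution R n (N × Q) := by
  cases n with
  | zero => exact HasGorensteinChain.prod h hQ
  | succ n =>
    obtain ⟨K, G, ⟨f, g, hf, hfg, hg⟩, hG, hK⟩ := h
    refine ⟨K, ModuleCat.of R (G × Q), ⟨LinearMap.inl R G Q ∘ₗ f, g.prodMap LinearMap.id,
      LinearMap.inl_injective.comp hf, ?_, ?_⟩, hG.prod hQ, hK⟩
    · rintro ⟨x, q⟩
      simp only [LinearMap.prodMap_apply, LinearMap.id_apply, Prod.mk_eq_zero, LinearMap.coe_comp,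
        LinearMap.coe_inl, Set.mem_range, Function.comp_apply, Prod.mk.injEq, hfg x]
      exact ⟨fun ⟨⟨a, ha⟩, hq⟩ => ⟨a, ha, hq.symm⟩, fun ⟨a, ha, hq⟩ => ⟨⟨a, ha⟩, hq.symm⟩⟩
    · exact hg.prodMap Function.surjective_id

/-- For positive length, G is replaced by the preimage of A, the kernel of G → E → B; K stays the
same. -/
theorem IsExtensionOf.hasChainResolution_left {n : ℕ} (hE : IsExtensionOf R A E B)
    (h : HasChainResolution R n E) (hB : HasGorensteinChain R B) : HasChainResolution R n A := by
  cases n with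
  | zero => exact hE.hasGorensteinChain_left h hB
  | succ n =>
    obtain ⟨K, G, ⟨f, g, hf, hfg, hg⟩, hG, hK⟩ := h
    obtain ⟨i, π, hi, hiπ, hπ⟩ := hE
    let κ : G →ₗ[R] B := π ∘ₗ g
    obtain ⟨ρ, hρ⟩ := hiπ.exists_lift hi (g ∘ₗ (LinearMap.ker κ).subtype) fun x => x.2
    have hρ' : ∀ x : LinearMap.ker κ, i (ρ x) = g x := hρ
    refine ⟨K, ModuleCat.of R (LinearMap.ker κ), ⟨f.codRestrict (LinearMap.ker κ) fun x => ?_, ρ,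
      ?_, ?_, ?_⟩, ?_, hK⟩
    · simp [κ, hfg.apply_apply_eq_zero]
    · exact fun x y hxy => hf (congrArg Subtype.val hxy)
    · intro x
      rw [← map_eq_zero_iff i hi, hρ', hfg]
      exact ⟨fun ⟨k, hk⟩ => ⟨k, Subtype.ext hk⟩, fun ⟨k, hk⟩ => ⟨k, congrArg Subtype.val hk⟩⟩
    · intro a
      obtain ⟨x, hx⟩ := hg (i a)
      exact ⟨⟨x, by simp [κ, hx, hiπ.apply_apply_eq_zero]⟩, hi ((hρ' _).trans hx)⟩
    · refine IsExtensionOf.hasGorensteinChain_left (E := G) (B := B) ?_ hG hB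
      exact ⟨(LinearMap.ker κ).subtype, κ, Subtype.val_injective,
        LinearMap.exact_subtype_ker_map κ, hπ.comp hg⟩

/-- Rotating 0 → K → G → Z 0 → 0 along the first step gives 0 → Z 1 → K × P → G → 0, so Z 1 has a
resolution shorter by one. By induction Z 1 has a chain, which `HasGorensteinChain.of_step_left`
carries back to Z 0. -/
theorem HasChainResolution.hasGorensteinChain {n : ℕ} {Z : ℕ → ModuleCat.{w} R}
    (hZ : ∀ i, GorensteinStep R (Z (i + 1)) (Z i)) (h : HasChainResolution R n (Z 0)) :
    HasGorensteinChain R (Z 0) := by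
  induction n generalizing Z with
  | zero => exact h
  | succ n ih =>
    obtain ⟨K, G, hE, hG, hK⟩ := h
    obtain ⟨P, hP, hX⟩ := hE.exists_cone (hZ 0)
    have h1 := hX.hasChainResolution_left (hK.prod hP) hG
    exact (ih (Z := fun i => Z (i + 1)) (fun i => hZ (i + 1)) h1).of_step_left (hZ 0)

end Extension

/-! ### Translation between resolutions and chains -/

section Bridge

theorem IsGorensteinProjective.exists_chain {R : Type u} [CommRing R] {M : Type v}
    [AddCommGroup M] [Module R M] (h : IsGorensteinProjective R M) :
    ∃ Z : ℤ → ModuleCat.{max u v} R, (∀ i, GorensteinStep R (Z (i + 1)) (Z i)) ∧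
      Nonempty (M ≃ₗ[R] Z 0) := by
  obtain ⟨P, d, hP, hd, hQ, he⟩ := h
  refine ⟨fun i => ModuleCat.of R (LinearMap.range (d i)), fun i => ?_, he⟩
  refine IsGorensteinStep.step (f := (LinearMap.range (d (i + 1))).subtype)
    (g := (d i).rangeRestrict) ⟨hP _, Subtype.val_injective, ?_,
      LinearMap.surjective_rangeRestrict _, ?_⟩
  · intro x
    rw [Subtype.ext_iff]
    refine (hd i x).trans ?_
    exact ⟨fun ⟨y, hy⟩ => ⟨⟨x, y, hy⟩, rfl⟩, fun ⟨⟨x', y, hy⟩, hx⟩ => ⟨y, hy.trans hx⟩⟩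
  · intro Q _ _ hQ' k
    obtain ⟨k', hk'⟩ := (hQ Q hQ' (i + 1) (k ∘ₗ (d (i + 1)).rangeRestrict)).1 (by
      refine LinearMap.ext fun x => ?_
      have : (d (i + 1)).rangeRestrict (d (i + 1 + 1) x) = 0 :=
        Subtype.ext ((hd (i + 1)).apply_apply_eq_zero x)
      change k ((d (i + 1)).rangeRestrict (d (i + 1 + 1) x)) = 0
      rw [this, map_zero])
    refine ⟨k', ?_⟩
    rintro ⟨_, y, rfl⟩
    exact LinearMap.congr_fun hk' y

theorem IsGorensteinProjective.of_chain {R : Type u} [CommRing R] {M : Type v} [AddCommGroup M]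
    [Module R M] {Z : ℤ → ModuleCat.{max u v} R} (hZ : ∀ i, GorensteinStep R (Z (i + 1)) (Z i))
    (e : M ≃ₗ[R] Z 0) : IsGorensteinProjective R M := by
  have hZ' : ∀ i, GorensteinStep R (Z i) (Z (i - 1)) := fun i => by
    have := hZ (i - 1)
    rwa [sub_add_cancel] at this
  choose P f g h using hZ'
  -- The target of `g (i + 1)` is `Z (i + 1 - 1)`; a free index equal to it avoids a cast to `Z i`.
  have hf : ∀ (i j : ℤ) (_ : i = j - 1), ∃ g' : P j →ₗ[R] Z i,
      Function.Exact (f j) g' ∧ Function.Surjective g' := by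
    rintro i j rfl
    exact ⟨g j, (h j).exact, (h j).surjective⟩
  choose g' hg' hg'' using fun i : ℤ => hf i (i + 1) (add_sub_cancel_right i 1).symm
  refine ⟨P, fun i => f i ∘ₗ g' i, fun i => (h i).projective, fun i x => ?_,
    fun Q _ _ hQ i k => ?_, ⟨?_⟩⟩
  · rw [LinearMap.comp_apply, map_eq_zero_iff _ (h i).injective, hg' i]
    constructor
    · rintro ⟨z, rfl⟩
      obtain ⟨y, rfl⟩ := hg'' (i + 1) z
      exact ⟨y, rfl⟩
    · rintro ⟨y, rfl⟩
      exact ⟨_, rfl⟩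
  · constructor
    · intro hk
      have hk' : ∀ z, k (f (i + 1) z) = 0 := fun z => by
        obtain ⟨y, rfl⟩ := hg'' (i + 1) z
        exact LinearMap.congr_fun hk y
      obtain ⟨m, hm⟩ := (hg' i).exists_desc (hg'' i) k hk'
      obtain ⟨m', hm'⟩ := (h i).extend Q hQ m
      exact ⟨m', LinearMap.ext fun x => (hm' _).trans (hm x)⟩
    · rintro ⟨m, rfl⟩
      refine LinearMap.ext fun x => ?_
      change m (f i (g' i (f (i + 1) (g' (i + 1) x)))) = 0
      rw [(hg' i).apply_apply_eq_zero, map_zero, map_zero]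
  · have : LinearMap.range (f 0 ∘ₗ g' 0) = LinearMap.range (f 0) :=
      LinearMap.range_comp_of_range_eq_top _ (LinearMap.range_eq_top.2 (hg'' 0))
    exact e.trans ((LinearEquiv.ofInjective (f 0) (h 0).injective).trans
      (LinearEquiv.ofEq _ _ this.symm))

theorem isGorensteinProjective_iff_hasGorensteinChain {R : Type u} [CommRing R]
    {M : Type (max u v)} [AddCommGroup M] [Module R M] :
    IsGorensteinProjective.{u, max u v} R M ↔ HasGorensteinChain.{u, max u v} R M :=
  ⟨fun h => h.exists_chain, fun ⟨_, hZ, ⟨e⟩⟩ => .of_chain hZ e⟩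

theorem IsSuperFinitelyPresented.of_chain {R : Type u} [CommRing R] {M : Type v} [AddCommGroup M]
    [Module R M] {Z : ℕ → ModuleCat.{max u v} R}
    (hZ : ∀ i, FiniteGorensteinStep R (Z (i + 1)) (Z i)) (e : M ≃ₗ[R] Z 0) :
    IsSuperFinitelyPresented R M := by
  choose P f g hfin h using hZ
  refine ⟨P, fun i => f i ∘ₗ g (i + 1), e.symm.toLinearMap ∘ₗ g 0,
    fun i => ⟨hfin i, (h i).projective⟩, fun i x => ?_, fun x => ?_,
    e.symm.surjective.comp (h 0).surjective⟩
  · rw [LinearMap.comp_apply, map_eq_zero_iff _ (h i).injective, (h (i + 1)).exact]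
    constructor
    · rintro ⟨z, rfl⟩
      obtain ⟨y, rfl⟩ := (h (i + 1 + 1)).surjective z
      exact ⟨y, rfl⟩
    · rintro ⟨y, rfl⟩
      exact ⟨_, rfl⟩
  · rw [LinearMap.comp_apply, LinearEquiv.coe_coe, LinearEquiv.map_eq_zero_iff, (h 0).exact]
    constructor
    · rintro ⟨z, rfl⟩
      obtain ⟨y, rfl⟩ := (h (0 + 1)).surjective z
      exact ⟨y, rfl⟩
    · rintro ⟨y, rfl⟩
      exact ⟨_, rfl⟩

theorem HasGorensteinProjectiveResolution.hasChainResolution {R : Type u} [CommRing R] {n : ℕ}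
    {N : Type (max u v)} [AddCommGroup N] [Module R N]
    (h : HasGorensteinProjectiveResolution.{u, max u v} R N n) :
    HasChainResolution.{u, max u v} R n N := by
  induction n generalizing N with
  | zero =>
    obtain ⟨G, d, ε, hG, h0, -, hex, hε⟩ := h
    have := h0 1 one_pos
    have hinj : Function.Injective ε := by
      rw [injective_iff_map_eq_zero]
      intro x hx
      obtain ⟨y, rfl⟩ := (hex x).1 hx
      rw [Subsingleton.elim y 0, map_zero]
    exact (isGorensteinProjective_iff_hasGorensteinChain.1 (hG 0)).congr
      (LinearEquiv.ofBijective ε ⟨hinj, hε⟩).symm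
  | succ n ih =>
    obtain ⟨G, d, ε, hG, h0, hd, hex, hε⟩ := h
    refine ⟨ModuleCat.of R (LinearMap.ker ε), G 0, ⟨(LinearMap.ker ε).subtype, ε,
      Subtype.val_injective, LinearMap.exact_subtype_ker_map ε, hε⟩,
      isGorensteinProjective_iff_hasGorensteinChain.1 (hG 0), ih ?_⟩
    refine ⟨fun i => G (i + 1), fun i => d (i + 1),
      (d 0).codRestrict (LinearMap.ker ε) fun x => hex.apply_apply_eq_zero x,
      fun i => hG _, fun k hk => h0 _ (by omega), fun i => hd _, fun x => ?_, ?_⟩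
    · rw [← hd 0 x, Subtype.ext_iff]
      rfl
    · rintro ⟨x, hx⟩
      obtain ⟨y, hy⟩ := (hex x).1 hx
      exact ⟨y, Subtype.ext hy⟩

theorem exists_hasGorensteinProjectiveResolution {R : Type u} [CommRing R] {N : Type v}
    [AddCommGroup N] [Module R N] (h : gorensteinProjectiveDim R N < ⊤) :
    ∃ n, HasGorensteinProjectiveResolution R N n := by
  by_contra! hn
  simp [gorensteinProjectiveDim, hn] at h

end Bridge

/-! ### Finite supports of maps into free modules -/

section FiniteSupport

theorem Module.Finite.exists_finset_support_subset {R N ι : Type*} [CommRing R] [AddCommGroup N]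
    [Module R N] [Module.Finite R N] (φ : N →ₗ[R] ι →₀ R) :
    ∃ J : Finset ι, ∀ x, (φ x).support ⊆ J := by
  classical
  obtain ⟨s, hs⟩ := Module.Finite.fg_top (R := R) (M := N)
  refine ⟨s.biUnion fun x => (φ x).support, fun x => ?_⟩
  rw [← Finset.coe_subset, ← Finsupp.mem_supported R]
  have hle : Submodule.span R (s : Set N) ≤ (Finsupp.supported R R
      ((s.biUnion fun x => (φ x).support : Finset ι) : Set ι)).comap φ := by
    rw [Submodule.span_le]
    intro y hy
    change φ y ∈ Finsupp.supported R R _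
    rw [Finsupp.mem_supported, Finset.coe_subset]
    exact Finset.subset_biUnion_of_mem (fun x => (φ x).support) hy
  exact hle (hs ▸ Submodule.mem_top)

/-- As R embeds in its fraction field, supports are unchanged by base change, where the source is
finite-dimensional. -/
theorem exists_finset_support_subset_of_fractionRing {R M ι : Type*} [CommRing R] [IsDomain R]
    [AddCommGroup M] [Module R M] [Module.Finite (FractionRing R) (FractionRing R ⊗[R] M)]
    (φ : M →ₗ[R] ι →₀ R) : ∃ J : Finset ι, ∀ x, (φ x).support ⊆ J := by
  let ψ : M →ₗ[R] ι →₀ FractionRing R :=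
    Finsupp.mapRange.linearMap (Algebra.linearMap R (FractionRing R)) ∘ₗ φ
  obtain ⟨J, hJ⟩ := Module.Finite.exists_finset_support_subset
    (LinearMap.liftBaseChange (FractionRing R) ψ)
  refine ⟨J, fun x i hi => hJ (1 ⊗ₜ x) ?_⟩
  rw [LinearMap.liftBaseChange_tmul, one_smul, Finsupp.mem_support_iff]
  simpa [ψ] using hi

/-- A map into a projective module, supported on finitely many members of a dual basis, factors
through a finite free module. -/
theorem exists_factor_pi_of_support_subset {R : Type*} {M P : Type*} [CommRing R]
    [AddCommGroup M] [AddCommGroup P] [Module R M] [Module R P] {s : P →ₗ[R] P →₀ R}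
    (hs : Finsupp.linearCombination R id ∘ₗ s = LinearMap.id) (f : M →ₗ[R] P) {J : Finset P}
    (hJ : ∀ x, (s (f x)).support ⊆ J) (x : M) : ∑ j : J, s (f x) j • (j : P) = f x := by
  have h : Finsupp.linearCombination R id (s (f x)) = f x := LinearMap.congr_fun hs (f x)
  rw [Finsupp.linearCombination_apply, Finsupp.sum_of_support_subset _ (hJ x) _ (by simp)] at h
  rw [← Finset.sum_coe_sort J] at h
  exact h

end FiniteSupport

/-! ### Finite coresolutions and their duals -/

section FiniteStep

variable {R : Type u} [CommRing R]

/-- The embedding f into P factors as θ ∘ φ through R^J. Hence φ is injective, and extensions along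
f restrict along θ to extensions along φ. -/
theorem HasGorensteinChain.exists_finiteGorensteinStep [IsDomain R] {M : Type (max u v)}
    [AddCommGroup M] [Module R M] [Module.Finite (FractionRing R) (FractionRing R ⊗[R] M)]
    (h : HasGorensteinChain.{u, max u v} R M) :
    ∃ N : ModuleCat.{max u v} R, FiniteGorensteinStep.{u, max u v} R M N ∧
      HasGorensteinChain.{u, max u v} R N ∧ Module.Finite R N := by
  obtain ⟨B, ⟨P, f, g, hfg⟩, hB⟩ := h.exists_right
  obtain ⟨s, hs⟩ := Module.projective_def'.1 hfg.projective
  obtain ⟨J, hJ⟩ := exists_finset_support_subset_of_fractionRing (s ∘ₗ f)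
  let φ : M →ₗ[R] J → R := LinearMap.pi fun j => Finsupp.lapply (j : P) ∘ₗ s ∘ₗ f
  let θ : (J → R) →ₗ[R] P := Fintype.linearCombination R fun j : J => (j : P)
  have hθ : ∀ x, θ (φ x) = f x := fun x => by
    rw [Fintype.linearCombination_apply]
    exact exists_factor_pi_of_support_subset hs f hJ x
  have hstep : IsGorensteinStep φ (LinearMap.range φ).mkQ := by
    refine ⟨inferInstance, fun x y hxy => hfg.injective ?_, LinearMap.exact_map_mkQ_range φ,
      Submodule.mkQ_surjective _, fun Q _ _ hQ k => ?_⟩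
    · rw [← hθ, hxy, hθ]
    · obtain ⟨k', hk'⟩ := hfg.extend Q hQ k
      exact ⟨k' ∘ₗ θ, fun x => by rw [LinearMap.comp_apply, hθ, hk']⟩
  refine ⟨ModuleCat.of R ((J → R) ⧸ LinearMap.range φ),
    ⟨ModuleCat.of R (J → R), φ, (LinearMap.range φ).mkQ, inferInstanceAs (Module.Finite R (J → R)),
      hstep⟩, ?_, inferInstanceAs (Module.Finite R ((J → R) ⧸ LinearMap.range φ))⟩
  obtain ⟨e⟩ := hstep.schanuel hfg
  exact ((hB.prod (Q := J → R) inferInstance).congr e).of_prod hfg.projective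

theorem HasGorensteinChain.exists_finite_chain [IsDomain R] {M : Type (max u v)}
    [AddCommGroup M] [Module R M] [hfin : Module.Finite (FractionRing R) (FractionRing R ⊗[R] M)]
    (h : HasGorensteinChain.{u, max u v} R M) :
    ∃ Z : ℕ → ModuleCat.{max u v} R, Z 0 = ModuleCat.of R M ∧
      ∀ n, FiniteGorensteinStep.{u, max u v} R (Z n) (Z (n + 1)) := by
  obtain ⟨Z, h0, hZ⟩ := exists_forall_nat_of_step
    (C := fun X : ModuleCat.{max u v} R => HasGorensteinChain.{u, max u v} R X ∧
      Module.Finite (FractionRing R) (FractionRing R ⊗[R] X))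
    (r := fun X Y : ModuleCat.{max u v} R => FiniteGorensteinStep.{u, max u v} R X Y)
    (fun X ⟨hX, hX'⟩ => by
      obtain ⟨Y, h1, h2, h3⟩ := hX.exists_finiteGorensteinStep
      exact ⟨Y, h1, h2, inferInstance⟩)
    (a := ModuleCat.of R M) ⟨h, hfin⟩
  exact ⟨Z, h0, fun n => (hZ n).2⟩

section Dual

variable {A B P : Type (max u v)} [AddCommGroup A] [AddCommGroup B] [AddCommGroup P] [Module R A]
  [Module R B] [Module R P]

theorem IsGorensteinStep.dualMap_surjective {f : A →ₗ[R] P} {g : P →ₗ[R] B}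
    (h : IsGorensteinStep.{u, max u v} f g) : Function.Surjective f.dualMap := by
  intro α
  -- The extension property only tests modules in the universe of A, so R is lifted there.
  let e : ULift.{max u v} R ≃ₗ[R] R := ULift.moduleEquiv
  obtain ⟨α', hα'⟩ := h.extend (ULift.{max u v} R) inferInstance (e.symm.toLinearMap ∘ₗ α)
  refine ⟨e.toLinearMap ∘ₗ α', LinearMap.ext fun a => ?_⟩
  simp [LinearMap.dualMap_apply, hα']

theorem FiniteGorensteinStep.finite_dual (h : FiniteGorensteinStep.{u, max u v} R A B) :
    Module.Finite R (Module.Dual R A) := by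
  obtain ⟨P, f, g, hP, h⟩ := h
  have := h.projective
  exact Module.Finite.of_surjective _ h.dualMap_surjective

theorem FiniteGorensteinStep.eval_injective (h : FiniteGorensteinStep.{u, max u v} R A B) :
    Function.Injective (Module.Dual.eval R A) := by
  obtain ⟨P, f, g, hP, h⟩ := h
  have := h.projective
  intro x y hxy
  refine h.injective ((Module.bijective_dual_eval R P).1 (LinearMap.ext fun α => ?_))
  exact LinearMap.congr_fun hxy (f.dualMap α)

/-- An element of A^** comes from some p in the reflexive module P; p dies in B^**, hence in B, and
so lies in A. -/
theorem FiniteGorensteinStep.isReflexive (h : FiniteGorensteinStep.{u, max u v} R A B)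
    (hB : Function.Injective (Module.Dual.eval R B)) : Module.IsReflexive R A := by
  refine ⟨h.eval_injective, fun φ => ?_⟩
  obtain ⟨P, f, g, hP, h⟩ := h
  have := h.projective
  obtain ⟨p, hp⟩ := (Module.bijective_dual_eval R P).2 (φ ∘ₗ f.dualMap)
  have hp' : ∀ β : Module.Dual R P, β p = φ (f.dualMap β) := fun β => LinearMap.congr_fun hp β
  have hgp : g p = 0 := by
    refine hB (LinearMap.ext fun β => ?_)
    rw [map_zero, LinearMap.zero_apply, Module.Dual.eval_apply]
    have := hp' (g.dualMap β)
    rwa [show f.dualMap (g.dualMap β) = 0 from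
      LinearMap.ext fun a => by simp [LinearMap.dualMap_apply, h.exact.apply_apply_eq_zero],
      map_zero] at this
  obtain ⟨a, rfl⟩ := (h.exact p).1 hgp
  refine ⟨a, LinearMap.ext fun α => ?_⟩
  obtain ⟨β, rfl⟩ := h.dualMap_surjective α
  exact hp' β

theorem FiniteGorensteinStep.dual (h : FiniteGorensteinStep.{u, max u v} R A B)
    (hB : Module.IsReflexive R B) (hB' : Module.Finite R (Module.Dual R B)) :
    FiniteGorensteinStep.{u, max u v} R (Module.Dual R B) (Module.Dual R A) := by
  obtain ⟨P, f, g, hP, h⟩ := h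
  have := h.projective
  refine ⟨ModuleCat.of R (Module.Dual R P), g.dualMap, f.dualMap,
    inferInstanceAs (Module.Finite R (Module.Dual R P)),
    inferInstanceAs (Module.Projective R (Module.Dual R P)),
    LinearMap.dualMap_injective_of_surjective h.surjective, fun α => ⟨fun hα => ?_, ?_⟩,
    h.dualMap_surjective, fun Q _ _ hQ k => ?_⟩
  · obtain ⟨β, hβ⟩ := h.exact.exists_desc h.surjective (α : P →ₗ[R] R)
      fun a => LinearMap.congr_fun hα a
    exact ⟨β, LinearMap.ext hβ⟩
  · rintro ⟨β, rfl⟩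
    exact LinearMap.ext fun a => by
      simp [LinearMap.dualMap_apply, h.exact.apply_apply_eq_zero]
  · obtain ⟨s, hs⟩ := Module.projective_def'.1 hQ
    obtain ⟨J, hJ⟩ := Module.Finite.exists_finset_support_subset (s ∘ₗ k)
    -- Each coordinate of k is a functional on B^*, hence evaluation at an element of B, which lifts
    -- to P. Finitely many coordinates matter, so evaluations at these lifts sum to the extension.
    have hx : ∀ j : Q, ∃ p : P, ∀ β : Module.Dual R B, β (g p) = s (k β) j := fun j => by
      obtain ⟨b, hb⟩ := (Module.bijective_dual_eval R B).2 (Finsupp.lapply j ∘ₗ s ∘ₗ k)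
      obtain ⟨p, rfl⟩ := h.surjective b
      exact ⟨p, fun β => LinearMap.congr_fun hb β⟩
    choose x hx using hx
    refine ⟨∑ j : J, (Module.Dual.eval R P (x j)).smulRight (j : Q), fun β => ?_⟩
    rw [← exists_factor_pi_of_support_subset hs k hJ β, LinearMap.sum_apply]
    refine Finset.sum_congr rfl fun j _ => ?_
    rw [← hx]
    rfl

end Dual

/-- The dual of a chain of finite Gorenstein steps is a chain of finite Gorenstein steps. -/
theorem FiniteGorensteinStep.dual_chain {Z : ℕ → ModuleCat.{max u v} R}
    (hZ : ∀ n, FiniteGorensteinStep.{u, max u v} R (Z n) (Z (n + 1))) (n : ℕ) :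
    FiniteGorensteinStep.{u, max u v} R (Module.Dual R (Z (n + 1))) (Module.Dual R (Z n)) :=
  (hZ n).dual ((hZ (n + 1)).isReflexive (hZ (n + 2)).eval_injective) (hZ (n + 1)).finite_dual

theorem HasGorensteinChain.exists_dual_chain [IsDomain R] {M : Type (max u v)}
    [AddCommGroup M] [Module R M] [Module.Finite (FractionRing R) (FractionRing R ⊗[R] M)]
    (h : HasGorensteinChain.{u, max u v} R M) : Module.IsReflexive R M ∧
    ∃ Z : ℕ → ModuleCat.{max u v} R, Z 0 = ModuleCat.of R (Module.Dual R M) ∧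
      ∀ n, FiniteGorensteinStep.{u, max u v} R (Z (n + 1)) (Z n) := by
  obtain ⟨Z, h0, hZ⟩ := h.exists_finite_chain
  have hr := (hZ 0).isReflexive (hZ 1).eval_injective
  rw [h0] at hr
  refine ⟨hr, fun n => ModuleCat.of R (Module.Dual R (Z n)), ?_,
    FiniteGorensteinStep.dual_chain hZ⟩
  change ModuleCat.of R (Module.Dual R (Z 0)) = _
  rw [h0]

theorem HasGorensteinChain.isSuperFinitelyPresented_of_equiv_dual [IsDomain R] {N : Type v}
    {M : Type (max u v)} [AddCommGroup N] [Module R N] [AddCommGroup M] [Module R M]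
    [Module.Finite (FractionRing R) (FractionRing R ⊗[R] M)]
    (h : HasGorensteinChain.{u, max u v} R M) (e : N ≃ₗ[R] Module.Dual R M) :
    IsSuperFinitelyPresented.{u, v} R N := by
  obtain ⟨-, Z, h0, hZ⟩ := h.exists_dual_chain
  refine IsSuperFinitelyPresented.of_chain hZ ?_
  rw [h0]
  exact e

theorem HasGorensteinProjectiveResolution.congr {n : ℕ} {M N : Type v} [AddCommGroup M]
    [AddCommGroup N] [Module R M] [Module R N] (h : HasGorensteinProjectiveResolution R M n)
    (e : M ≃ₗ[R] N) : HasGorensteinProjectiveResolution R N n := by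
  obtain ⟨G, d, ε, hG, h0, hd, hex, hε⟩ := h
  exact ⟨G, d, e.toLinearMap ∘ₗ ε, hG, h0, hd,
    fun x => ((e.map_eq_zero_iff (x := ε x))).trans (hex x), e.surjective.comp hε⟩

theorem HasGorensteinChain.dual_of_gorensteinProjectiveDim_lt_top [IsDomain R]
    {M N : Type (max u v)} [AddCommGroup M] [AddCommGroup N] [Module R M] [Module R N]
    [Module.Finite (FractionRing R) (FractionRing R ⊗[R] M)]
    (h : HasGorensteinChain.{u, max u v} R M) (e : N ≃ₗ[R] Module.Dual R M)
    (hdim : gorensteinProjectiveDim.{u, max u v} R N < ⊤) :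
    HasGorensteinChain.{u, max u v} R (Module.Dual R M) := by
  obtain ⟨-, Z, h0, hZ⟩ := h.exists_dual_chain
  obtain ⟨n, hn⟩ := exists_hasGorensteinProjectiveResolution hdim
  have hn' : HasChainResolution.{u, max u v} R n (Z 0) := by
    rw [h0]
    exact HasGorensteinProjectiveResolution.hasChainResolution (hn.congr e)
  have := hn'.hasGorensteinChain fun i => (hZ i).step
  rwa [h0] at this

theorem HasGorensteinChain.finite_dual [IsDomain R] {M : Type (max u v)}
    [AddCommGroup M] [Module R M] [Module.Finite (FractionRing R) (FractionRing R ⊗[R] M)]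
    (h : HasGorensteinChain.{u, max u v} R M) : Module.Finite R (Module.Dual R M) := by
  obtain ⟨Z, h0, hZ⟩ := h.exists_finite_chain
  have := (hZ 0).finite_dual
  rwa [h0] at this

end FiniteStep

/-! ### Universe lifting and the main theorem -/

section Main

theorem finite_fractionRing_tensorProduct_uLift {R : Type u} [CommRing R] [IsDomain R] {M : Type v}
    [AddCommGroup M] [Module R M] (h : domainRank R M < Cardinal.aleph0) :
    Module.Finite (FractionRing R) (FractionRing R ⊗[R] ULift.{u} M) := by
  have : Module.Finite (FractionRing R) (FractionRing R ⊗[R] M) := Module.rank_lt_aleph0_iff.1 h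
  exact Module.Finite.equiv
    (LinearEquiv.baseChange R (FractionRing R) _ _ ULift.moduleEquiv.{u, v, u}.symm)

theorem IsGorensteinProjective.hasGorensteinChain_uLift {R : Type u} [CommRing R] {M : Type v}
    [AddCommGroup M] [Module R M] (h : IsGorensteinProjective R M) :
    HasGorensteinChain.{u, max u v} R (ULift.{u} M) := by
  obtain ⟨Z, hZ, ⟨e⟩⟩ := h.exists_chain
  exact ⟨Z, hZ, ⟨ULift.moduleEquiv.trans e⟩⟩

theorem IsGorensteinProjective.superFinitelyPresented_and_dual {R : Type u} [CommRing R]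
    [IsDomain R] {M : Type v} [AddCommGroup M] [Module R M] (h : IsGorensteinProjective R M)
    (hrank : domainRank R M < Cardinal.aleph0)
    (hdim : gorensteinProjectiveDim R (Module.Dual R M) < ⊤) :
    IsSuperFinitelyPresented R M ∧ IsGorensteinProjective R (Module.Dual R M) := by
  have hfin := finite_fractionRing_tensorProduct_uLift hrank
  have hM := h.hasGorensteinChain_uLift
  let e : ULift.{u} M ≃ₗ[R] M := ULift.moduleEquiv
  have hD := hM.dual_of_gorensteinProjectiveDim_lt_top e.dualMap hdim
  have := hM.finite_dual
  have := hM.exists_dual_chain.1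
  -- The finite presentation result is applied to the dual, whose finite generation gives finite
  -- rank; reflexivity identifies M with its double dual.
  exact ⟨hD.isSuperFinitelyPresented_of_equiv_dual (e.symm.trans (Module.evalEquiv R _)),
    isGorensteinProjective_iff_hasGorensteinChain.2 (hD.congr e.dualMap)⟩

theorem IsGorensteinProjective.isSuperFinitelyPresented_dual {R : Type u} [CommRing R]
    [IsDomain R] {M : Type v} [AddCommGroup M] [Module R M] (h : IsGorensteinProjective R M)
    (hrank : domainRank R M < Cardinal.aleph0) :
    IsSuperFinitelyPresented R (Module.Dual R M) := by
  have hfin := finite_fractionRing_tensorProduct_uLift hrank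
  exact HasGorensteinChain.isSuperFinitelyPresented_of_equiv_dual.{u, max u v}
    h.hasGorensteinChain_uLift (LinearEquiv.dualMap ULift.moduleEquiv.{u, v, u})

end Main

theorem mainTheorem6 (R : Type u) [CommRing R] [IsDomain R] :
    (∀ (M : Type v) [AddCommGroup M] [Module R M],
      IsGorensteinProjective R M → domainRank R M < Cardinal.aleph0 →
      gorensteinProjectiveDim R (Module.Dual R M) < ⊤ →
        IsSuperFinitelyPresented R M ∧ IsGorensteinProjective R (Module.Dual R M)) ∧
    (HasPropertyB.{u, v} R → ∀ (M : Type v) [AddCommGroup M] [Module R M],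
      IsGorensteinProjective R M → domainRank R M < Cardinal.aleph0 →
        IsSuperFinitelyPresented R M ∧ IsGorensteinProjective R (Module.Dual R M)) := by
  refine ⟨fun M _ _ h hrank hdim => h.superFinitelyPresented_and_dual hrank hdim,
    fun hB M _ _ h hrank => h.superFinitelyPresented_and_dual hrank ?_⟩
  exact hB _ (h.isSuperFinitelyPresented_dual hrank)
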